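/- **Theorem (Correctness of Algorithm 2, triangle-loss persistent cycle minimization).** *Setting.* Let $V$ be a finite, linearly ordered vertex set and let $K_\bullet$: $K_{\epsilon_0}\subseteq\dots\subseteq K_{\epsilon_T}=K$, $\epsilon_0<\dots<\epsilon_T$ real, be a filtration by finite simplicial complexes with vertices in $V$, not necessarily simplex-wise. Fix a dimension $n\ge 0$. All chains, cycles $Z_n$, boundaries $B_n$ and (unreduced) homology groups $H_n=Z_n/B_n$ have rational coefficients; $S_k(K)$ is the set of $k$-simplices and $\partial_k\in\mathbb Q^{S_{k-1}(K)\times S_k(K)}$ the boundary matrix ($\partial_0=0$). For a simplex $\sigma$, $\mathrm{Birth}(\sigma)$ is the least $\epsilon_i$ with $\sigma\in K_{\epsilon_i}$. For an $n$-chain $c$, $\mathrm{Birth}(c)$ is the least $\epsilon_i$ with $c\in C_n(K_{\epsilon_i})$, $\mathrm{Death}(c)$ is the least $\epsilon_i$ with $c\in B_n(K_{\epsilon_i})$ ($\infty$ if $c\notin B_n(K)$), and $\mathcal L(c)=[\mathrm{Birth}(c),\mathrm{Death}(c))$. A set $\mathcal B\subseteq Z_n(K)$ is a *persistent homology cycle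 basis* of $K_\bullet$ (in dimension $n$) if $\mathcal L(z)\neq\emptyset$ for each $z\in\mathcal B$ and, for each $i$, the set $\{z\in\mathcal B:\epsilon_i\in\mathcal L(z)\}$ consists of cycles of $K_{\epsilon_i}$ whose classes are pairwise distinct and form a basis of $H_n(K_{\epsilon_i})$. A linear order on $S_k(K)$ is *filtration-preserving* if births are non-decreasing along it. Given linear orders on the rows and the columns of a matrix $D$, write $\mathrm{low}_A(j)$ for the last row in which the $j$-th column of a matrix $A$ is nonzero (defined when that column is nonzero). An *$R=DV$ decomposition* of $D$ is an equation $R=DU$ with $U$ invertible and upper triangular and $R$ reduced, i.e. $\mathrm{low}_R$ is injective. *Algorithm.* 1. Choose filtration-preserving linear orders $\le^{(k)}$ on the sets $S_k(K)$. (Breaking ties in birth by dimension, and then by these orders, they define a simplex-wise refinement of $K_\bullet$.) 2. Take an $R=DV$ decomposition $R=\partial_{n+1}U$ for these orders. Its birth/death pairs are $\Gamma=\{(\sigma,\tau)\in S_n(K)\times S_{n+1}(K):\mathrm{low}_R(\tau)=\sigma\}$. Put $\hat\Gamma=\{(\sigma,\tau)\in\Gamma:\mathrm{Birth}(\sigma)<\mathrm{Birth}(\tau)\}$.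 3. For each $(\sigma,\tau)\in\hat\Gamma$ let $$\mathcal F_n=\{\sigma'\in S_n(K):\mathrm{Birth}(\sigma')\le\mathrm{Birth}(\tau),\ \sigma<^{(n)}\sigma'\},$$ $$\mathcal F_{n+1}=\{\tau'\in S_{n+1}(K):\mathrm{Birth}(\sigma)\le\mathrm{Birth}(\tau'),\ \tau'<^{(n+1)}\tau\},$$ $\hat{\mathcal F}_{n+1}=\mathcal F_{n+1}\cup\{\tau\}$, and let $x^{\sigma,\tau}$ be an optimal solution of the triangle-loss program: minimize $\|Wv\|_1=\sum_\upsilon w_\upsilon|v_\upsilon|$ over $v\in G^{\hat{\mathcal F}_{n+1}}$ (extended by zero to an $(n+1)$-chain) subject to $(\partial_{n+1}v)_\sigma\ne0$, $(\partial_{n+1}v)_{\sigma'}=0$ for all $\sigma'\in\mathcal F_n$, and $v_\tau=1$. Here $W$ is a diagonal matrix with real entries $w_\upsilon\ge0$, and $G=\mathbb Q$ (nonintegral variant) or $G=\mathbb Z$ (integral variant). 4. Let $\hat{\mathcal D}=\{\partial_{n+1}x^{\sigma,\tau}:(\sigma,\tau)\in\hat\Gamma\}$ and $\hat{\mathcal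 D}'=\{z\in\mathcal M:\mathrm{Death}(z)=\infty\}$, where $\mathcal M$ is a basis calculated by the standard $R=DV$ method: for some filtration-preserving orders (possibly different from those of step 1) and some $R=DV$ decompositions $R_n=\partial_nU_n$ and $R_{n+1}=\partial_{n+1}U_{n+1}$, the set $\mathcal M$ consists of the columns $U_n[:,\sigma]$ for those $\sigma\in S_n(K)$ with $R_n[:,\sigma]=0$ that are not a value of $\mathrm{low}_{R_{n+1}}$, and of the columns $R_{n+1}[:,\tau]$ for those $\tau$ with $\sigma=\mathrm{low}_{R_{n+1}}(\tau)$ defined and $\mathrm{Birth}(\sigma)<\mathrm{Birth}(\tau)$. 5. Return $\mathcal D=\hat{\mathcal D}\cup\hat{\mathcal D}'$. *Claim.* For all choices of orders and decompositions: (a) in the nonintegral variant, the program in step 3 has an optimal solution for each $(\sigma,\tau)\in\hat\Gamma$; (b) in either variant, for each choice of optimal solutions $x^{\sigma,\tau}$, $(\sigma,\tau)\in\hat\Gamma$ (in the integral variant: provided that they exist), and for each such $\mathcal M$, the returned set $\mathcal D$ is a persistent homology cycle basis of $K_\bullet$ in dimension $n$. -/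

import Mathlib

open Matrix

noncomputable section

/-- A finite filtered simplicial complex `K_{ε₀} ⊆ K_{ε₁} ⊆ ⋯ ⊆ K_{ε_T} = K` with vertices in `V`,
indexed by real numbers `ε₀ < ⋯ < ε_T`. It need not be simplex-wise. (A simplicial complex is a
family of non-empty finite sets that is closed under non-empty subsets.) -/
structure Filtration (V : Type*) (T : ℕ) where
  eps : Fin (T + 1) → ℝ
  eps_strictMono : StrictMono eps
  sub : Fin (T + 1) → PreAbstractSimplicialComplex V
  sub_mono : Monotone sub

namespace Filtration

variable {V : Type*} {T : ℕ} (F : Filtration V T)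

/-- The whole complex `K = K_{ε_T}`. -/
def total : PreAbstractSimplicialComplex V := F.sub (Fin.last T)

/-- The simplices of `K` with `k` vertices, i.e. of dimension `k - 1`. Thus the set `S_n(K)` of
`n`-simplices is `F.Cells (n + 1)`, while `F.Cells 0` is empty. -/
abbrev Cells (k : ℕ) : Type _ := {s : Finset V // s ∈ F.total ∧ s.card = k}

instance [Finite V] (k : ℕ) : Fintype (F.Cells k) := Fintype.ofFinite _

open Classical in
/-- The smallest parameter `ε_i` at which `P i` holds, and `∞` if there is none. -/
def firstTime (P : Fin (T + 1) → Prop) : WithTop ℝ :=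
  (Finset.univ.filter P).inf fun i => ((F.eps i : ℝ) : WithTop ℝ)

/-- The birth parameter of a simplex. -/
def simplexBirth {k : ℕ} (s : F.Cells k) : WithTop ℝ := F.firstTime fun i => s.1 ∈ F.sub i

/-- The rational chains of `K` on simplices with `k` vertices: `C_n(K) = F.Chain (n + 1)`. -/
abbrev Chain (k : ℕ) : Type _ := F.Cells k → ℚ

/-- The chains of `K_{ε_i}`, as a subspace of the chains of `K`. -/
def chainsAt (k : ℕ) (i : Fin (T + 1)) : Submodule ℚ (F.Chain k) where
  carrier := {c | ∀ s, c s ≠ 0 → s.1 ∈ F.sub i}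
  zero_mem' := fun _ h => absurd rfl h
  add_mem' := by
    intro a b ha hb s h
    by_cases h0 : a s = 0
    · exact hb s fun h1 => h (by simp [h0, h1])
    · exact ha s h0
  smul_mem' := by
    intro r a ha s h
    exact ha s fun h1 => h (by simp [h1])

section homology

variable [LinearOrder V] [Finite V]

/-- The boundary matrix `∂_n`, rows labelled by `(n-1)`-simplices and columns by `n`-simplices. The
entry at `(s \ {v}, s)` is `(-1)^j`, where `j` is the position (from `0`) of the vertex `v` in the
increasing list of vertices of `s`; all other entries vanish. As `F.Cells 0` is empty, `∂_0 = 0`. -/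
def bdry (n : ℕ) : Matrix (F.Cells n) (F.Cells (n + 1)) ℚ := fun r s =>
  ∑ v ∈ s.1, if s.1.erase v = r.1 then (-1) ^ (s.1.filter (· < v)).card else 0

/-- The cycles `Z_n(K_{ε_i})`. -/
def cyclesAt (n : ℕ) (i : Fin (T + 1)) : Submodule ℚ (F.Chain (n + 1)) :=
  F.chainsAt (n + 1) i ⊓ LinearMap.ker (F.bdry n).mulVecLin

/-- The boundaries `B_n(K_{ε_i})`. -/
def boundariesAt (n : ℕ) (i : Fin (T + 1)) : Submodule ℚ (F.Chain (n + 1)) :=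
  (F.chainsAt (n + 2) i).map (F.bdry (n + 1)).mulVecLin

/-- The homology `H_n(K_{ε_i}) = Z_n(K_{ε_i}) / B_n(K_{ε_i})` with rational coefficients. -/
abbrev HomologyAt (n : ℕ) (i : Fin (T + 1)) : Type _ :=
  F.cyclesAt n i ⧸ (F.boundariesAt n i).submoduleOf (F.cyclesAt n i)

/-- `B` is a homological cycle basis for `H_n(K_{ε_i})`: it consists of cycles of `K_{ε_i}`, whose
classes are pairwise distinct and form a basis of the homology. -/
def IsHomologicalCycleBasis (n : ℕ) (i : Fin (T + 1)) (B : Set (F.Chain (n + 1))) : Prop :=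
  ∃ hB : B ⊆ F.cyclesAt n i,
    let cls : B → F.HomologyAt n i := fun z => Submodule.Quotient.mk ⟨z.1, hB z.2⟩
    LinearIndependent ℚ cls ∧ Submodule.span ℚ (Set.range cls) = ⊤

/-- The birth parameter of a chain. -/
def birth {n : ℕ} (c : F.Chain (n + 1)) : WithTop ℝ :=
  F.firstTime fun i => c ∈ F.chainsAt (n + 1) i

/-- The death parameter of a chain, `∞` if the chain is not a boundary in `K`. -/
def death {n : ℕ} (c : F.Chain (n + 1)) : WithTop ℝ :=
  F.firstTime fun i => c ∈ F.boundariesAt n i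

/-- The lifespan interval `[birth, death)`. -/
def lifespan {n : ℕ} (c : F.Chain (n + 1)) : Set ℝ :=
  {t | F.birth c ≤ (t : WithTop ℝ) ∧ (t : WithTop ℝ) < F.death c}

/-- A persistent homology cycle basis of the filtration, in dimension `n`. -/
def IsPersistentBasis (n : ℕ) (B : Set (F.Chain (n + 1))) : Prop :=
  (∀ z ∈ B, z ∈ F.cyclesAt n (Fin.last T)) ∧
  (∀ z ∈ B, (F.lifespan z).Nonempty) ∧
  ∀ i, F.IsHomologicalCycleBasis n i {z ∈ B | F.eps i ∈ F.lifespan z}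

end homology

/-- A linear order on a set of simplices is filtration-preserving if birth parameters ascend. -/
def Preserving {k : ℕ} (o : LinearOrder (F.Cells k)) : Prop :=
  ∀ a b, o.le a b → F.simplexBirth a ≤ F.simplexBirth b

end Filtration

section RDV

variable {ι κ : Type*}

/-- `low(j) = i` for the matrix `A`: the lowest nonzero entry of the column `j` is in row `i`. -/
def IsLow (oι : LinearOrder ι) (A : Matrix ι κ ℚ) (j : κ) (i : ι) : Prop :=
  A i j ≠ 0 ∧ ∀ i', A i' j ≠ 0 → oι.le i' i

/-- `R = D V` is an `R = DV` decomposition of `D`: the matrix `R` is reduced (the function `low` is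
injective) and `V` is invertible and upper triangular. -/
structure IsRDV [Fintype κ] [DecidableEq κ] (oι : LinearOrder ι) (oκ : LinearOrder κ)
    (D R : Matrix ι κ ℚ) (V : Matrix κ κ ℚ) : Prop where
  eq : R = D * V
  reduced : ∀ j j' i, IsLow oι R j i → IsLow oι R j' i → j = j'
  invertible : IsUnit V
  upper : ∀ a b, V a b ≠ 0 → oκ.le a b

end RDV

/-- The two kinds of coefficients in the triangle-loss program: integral and nonintegral. -/
inductive CoeffGroup
  | integers
  | rationals

/-- The admissible coefficients, as rational numbers. -/
def CoeffGroup.toSet : CoeffGroup → Set ℚ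
  | .integers => Set.range (Int.cast : ℤ → ℚ)
  | .rationals => Set.univ

namespace Filtration

variable {V : Type*} {T : ℕ} (F : Filtration V T) [LinearOrder V] [Finite V]

/-- `M` is a persistent homology cycle basis in dimension `n` as calculated by the standard
`R = DV` method: for some filtration-preserving orders and some decompositions
`R = ∂_n U`, `R' = ∂_{n+1} U'`, it consists of
* the columns of `U` at the `n`-simplices `s` in `H_n`, i.e. such that the column `s` of `R`
  vanishes and `s` is not a value of the function `low` of `R'`, and
* the columns of `R'` at the `(n+1)`-simplices `t` with `low(t) = s` born strictly before `t`. -/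
def IsStandardBasis (n : ℕ) (M : Set (F.Chain (n + 1))) : Prop :=
  ∃ (o : ∀ k, LinearOrder (F.Cells k)) (_ : ∀ k, F.Preserving (o k))
    (R : Matrix (F.Cells n) (F.Cells (n + 1)) ℚ)
    (U : Matrix (F.Cells (n + 1)) (F.Cells (n + 1)) ℚ)
    (R' : Matrix (F.Cells (n + 1)) (F.Cells (n + 2)) ℚ)
    (U' : Matrix (F.Cells (n + 2)) (F.Cells (n + 2)) ℚ),
    IsRDV (o n) (o (n + 1)) (F.bdry n) R U ∧
    IsRDV (o (n + 1)) (o (n + 2)) (F.bdry (n + 1)) R' U' ∧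
    M = {z | ∃ s, (∀ r, R r s = 0) ∧ (∀ t, ¬ IsLow (o (n + 1)) R' t s) ∧ z = fun a => U a s} ∪
        {z | ∃ s t, IsLow (o (n + 1)) R' t s ∧ F.simplexBirth s < F.simplexBirth t ∧
          z = fun a => R' a t}

/-- The set `Γ` of birth/death pairs `(s, t)` read off from the reduced matrix `R = ∂_{n+1} U`,
restricted to those with `Birth(s) < Birth(t)`. -/
def finitePairs {n : ℕ} (o : LinearOrder (F.Cells (n + 1)))
    (R : Matrix (F.Cells (n + 1)) (F.Cells (n + 2)) ℚ) :
    Set (F.Cells (n + 1) × F.Cells (n + 2)) :=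
  {p | IsLow o R p.2 p.1 ∧ F.simplexBirth p.1 < F.simplexBirth p.2}

section program

variable {n : ℕ} (o : ∀ k, LinearOrder (F.Cells k))
  (p : F.Cells (n + 1) × F.Cells (n + 2))

/-- `𝓕_n`, for the pair `p = (s, t)`: the `n`-simplices after `s` that are born by `Birth(t)`. -/
def lowerWindow : Set (F.Cells (n + 1)) :=
  {s' | F.simplexBirth s' ≤ F.simplexBirth p.2 ∧ (o (n + 1)).lt p.1 s'}

/-- `𝓕_{n+1}`, for the pair `p = (s, t)`: the `(n+1)`-simplices before `t` that are not born
before `Birth(s)`. -/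
def upperWindow : Set (F.Cells (n + 2)) :=
  {t' | F.simplexBirth p.1 ≤ F.simplexBirth t' ∧ (o (n + 2)).lt t' p.2}

/-- Feasible points of the triangle-loss program for the pair `p = (s, t)`. A vector indexed by
`𝓕_{n+1} ∪ {t}` is extended by zero to an `(n+1)`-chain. -/
structure Feasible (G : CoeffGroup) (v : F.Chain (n + 2)) : Prop where
  support : ∀ a, v a ≠ 0 → a ∈ insert p.2 (F.upperWindow o p)
  coeff : ∀ a, v a ∈ G.toSet
  at_birth : (F.bdry (n + 1) *ᵥ v) p.1 ≠ 0
  at_window : ∀ b ∈ F.lowerWindow o p, (F.bdry (n + 1) *ᵥ v) b = 0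
  at_death : v p.2 = 1

/-- The loss `‖W v‖₁` for the diagonal weight matrix `W` with entries `w`. -/
def loss (w : F.Cells (n + 2) → ℝ) (v : F.Chain (n + 2)) : ℝ := ∑ a, w a * |(v a : ℝ)|

/-- `v` is an optimal solution of the triangle-loss program for the pair `p`. -/
def IsSolution (G : CoeffGroup) (w : F.Cells (n + 2) → ℝ) (v : F.Chain (n + 2)) : Prop :=
  F.Feasible o p G v ∧ ∀ v', F.Feasible o p G v' → F.loss w v ≤ F.loss w v'

end program

/-- The set `𝓓` returned by the algorithm: the boundaries of the solutions `x p` of the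
triangle-loss programs for the pairs `p ∈ P`, and the elements of `M` that never die. -/
def output {n : ℕ} (P : Set (F.Cells (n + 1) × F.Cells (n + 2)))
    (x : F.Cells (n + 1) × F.Cells (n + 2) → F.Chain (n + 2)) (M : Set (F.Chain (n + 1))) :
    Set (F.Chain (n + 1)) :=
  {z | ∃ p ∈ P, z = F.bdry (n + 1) *ᵥ x p} ∪ {z ∈ M | F.death z = ⊤}

end Filtration

end

/-! The proof compares leading indices, as in Gaussian elimination. Since births ascend along a
filtration-preserving order, the leading simplex of a chain alone decides which `K_{ε_i}` contain it
(`mem_chainsAt_of_isLead`).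

A feasible point `v` for a pair `(σ, τ)` has lead `τ`, and its boundary has lead `σ`. So `∂v` is
born with `σ`. It dies with `τ`: if `∂v = ∂c` with `c` in a stage without `τ`, then `v - c` is a
cycle with lead `τ`, which forces the column `τ` of `R` to vanish. Only feasibility enters here, so
the basis claim is the same for both coefficient groups.

For spanning, `Submodule.le_of_forall_isLead` reduces an inclusion of subspaces to matching leading
indices. It is applied twice: cycles of `K_{ε_i}` lie in `B(K) ∩ C(K_{ε_i})` plus the span of the
immortal columns (`cyclesAt_le`), and `B(K) ∩ C(K_{ε_i})` lies in `B(K_{ε_i})` plus the span of the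
live `∂x` (`boundaries_inf_chainsAt_le`). The intermediate space depends on no order, so the two
halves may use unrelated orders and decompositions. For independence, immortal coefficients vanish
modulo `B(K)`, because their leads never lead a boundary; the remaining ones vanish by the death
argument applied to a combination of the `x`.

Optimal rational solutions exist because the condition at `σ` is redundant. The feasible set is then
a nonempty rational affine subspace, and a weighted `ℓ¹` norm is minimized there among finitely many
points of minimal support (`exists_min_weighted_norm`). -/

/-! ### Leading indices and subspaces. -/

/-- The last nonzero entry of the vector `b`, for the order `o`, is at the index `s`. -/
def IsLead {ι : Type*} (o : LinearOrder ι) (b : ι → ℚ) (s : ι) : Prop :=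
  b s ≠ 0 ∧ ∀ i, b i ≠ 0 → o.le i s

namespace IsLead

variable {ι : Type*} {o : LinearOrder ι}

theorem unique {b : ι → ℚ} {s s' : ι} (h : IsLead o b s) (h' : IsLead o b s') : s = s' :=
  o.le_antisymm _ _ (h'.2 _ h.1) (h.2 _ h'.1)

theorem ne_zero {b : ι → ℚ} {s : ι} (h : IsLead o b s) : b ≠ 0 := fun h0 => h.1 (by simp [h0])

end IsLead

theorem exists_isLead {ι : Type*} [Finite ι] (o : LinearOrder ι) {b : ι → ℚ} (hb : b ≠ 0) :
    ∃ s, IsLead o b s := by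
  obtain ⟨i, hi⟩ := Function.ne_iff.1 hb
  obtain ⟨s, hs, hmax⟩ := Set.exists_max_image {i | b i ≠ 0} id (Set.toFinite _) ⟨i, hi⟩
  exact ⟨s, hs, hmax⟩

/-- A subspace `N` is contained in `W` if each leading index in `N` occurs in `W ⊓ N`. -/
theorem Submodule.le_of_forall_isLead {ι : Type*} [Finite ι] (o : LinearOrder ι)
    {N W : Submodule ℚ (ι → ℚ)}
    (h : ∀ b ∈ N, ∀ s, IsLead o b s → ∃ w ∈ W, w ∈ N ∧ IsLead o w s) : N ≤ W := by
  have key : ∀ s, ∀ b ∈ N, IsLead o b s → b ∈ W := by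
    intro s
    induction s using (Finite.wellFounded_of_trans_of_irrefl o.lt).induction with
    | _ s ih =>
      intro b hb hs
      obtain ⟨w, hw, hwN, hws⟩ := h b hb s hs
      -- Cancels the leading entry. Since `w` lies in `N` as well, `c` stays in `N`, and its lead is
      -- strictly earlier.
      set c := b - (b s / w s) • w with hc
      have hcN : c ∈ N := N.sub_mem hb (N.smul_mem _ hwN)
      have hbc : b = c + (b s / w s) • w := by simp [hc]
      rw [hbc]
      refine W.add_mem ?_ (W.smul_mem _ hw)
      by_cases h0 : c = 0
      · rw [h0]; exact W.zero_mem
      obtain ⟨s', hs'⟩ := exists_isLead o h0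
      refine ih s' ?_ c hcN hs'
      have hcs : c s = 0 := by simp [hc, hws.1]
      have hne : s' ≠ s := by
        rintro rfl
        exact hs'.1 hcs
      refine lt_of_le_of_ne ?_ hne
      by_cases h1 : b s' = 0
      · refine hws.2 _ fun h2 => hs'.1 ?_
        simp [hc, h1, h2]
      · exact hs.2 _ h1
  intro b hb
  by_cases h0 : b = 0
  · rw [h0]; exact W.zero_mem
  · obtain ⟨s, hs⟩ := exists_isLead o h0
    exact key s b hb hs

/-! ### Reduced matrices and `R = DV` decompositions. -/

section Reduced

variable {ι κ : Type*} {oι : LinearOrder ι} {oκ : LinearOrder κ}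

theorem exists_isLow [Finite ι] {A : Matrix ι κ ℚ} {j : κ} {i : ι} (h : A i j ≠ 0) :
    ∃ s, IsLow oι A j s :=
  exists_isLead oι (b := fun i => A i j) fun h0 => h (congrFun h0 i)

/-- Among the columns with nonzero coefficient, exactly one attains the largest `low`, by
reducedness. Its lowest entry therefore cannot cancel. -/
theorem exists_isLead_mulVec_of_reduced [Finite ι] [Fintype κ] {R : Matrix ι κ ℚ}
    (hR : ∀ j j' i, IsLow oι R j i → IsLow oι R j' i → j = j')
    {c : κ → ℚ} {t : κ} {s : ι} (hc : c t ≠ 0) (hs : IsLow oι R t s) :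
    ∃ s' t', oι.le s s' ∧ IsLow oι R t' s' ∧ IsLead oι (R *ᵥ c) s' := by
  obtain ⟨s', ⟨t', hct', ht'⟩, hmax⟩ := Set.exists_max_image
    {i | ∃ j, c j ≠ 0 ∧ IsLow oι R j i} id (Set.toFinite _) ⟨s, t, hc, hs⟩
  have hle : ∀ i j, c j ≠ 0 → R i j ≠ 0 → ∃ l, IsLow oι R j l ∧ oι.le i l ∧ oι.le l s' := by
    intro i j hj hij
    obtain ⟨l, hl⟩ := exists_isLow (oι := oι) hij
    exact ⟨l, hl, hl.2 _ hij, hmax l ⟨j, hj, hl⟩⟩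
  refine ⟨s', t', hmax s ⟨t, hc, hs⟩, ht', ?_, ?_⟩
  · have : (R *ᵥ c) s' = R s' t' * c t' := by
      refine Finset.sum_eq_single t' (fun j _ hj => ?_) (by simp)
      by_contra h
      obtain ⟨l, hl, h1, h2⟩ := hle s' j (right_ne_zero_of_mul h) (left_ne_zero_of_mul h)
      obtain rfl := oι.le_antisymm _ _ h1 h2
      exact hj (hR _ _ _ hl ht')
    rw [this]
    exact mul_ne_zero ht'.1 hct'
  · intro i hi
    obtain ⟨j, _, hj⟩ := Finset.exists_ne_zero_of_sum_ne_zero hi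
    obtain ⟨l, _, h1, h2⟩ := hle i j (right_ne_zero_of_mul hj) (left_ne_zero_of_mul hj)
    exact oι.le_trans _ _ _ h1 h2

theorem diag_ne_zero_of_upper [Fintype κ] [DecidableEq κ] {V : Matrix κ κ ℚ} (hV : IsUnit V)
    (hu : ∀ a b, V a b ≠ 0 → oκ.le a b) (a : κ) : V a a ≠ 0 := by
  have hT : V.BlockTriangular id := by
    intro i j hij
    by_contra h
    exact absurd (hu i j h) (not_le_of_gt hij)
  have hdet := (Matrix.isUnit_iff_isUnit_det V).1 hV
  rw [show V.det = ∏ i, V i i by convert Matrix.det_of_isUpperTriangular hT] at hdet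
  exact Finset.prod_ne_zero_iff.1 hdet.ne_zero a (Finset.mem_univ a)

theorem IsLead.mulVec_of_upper [Fintype κ] {V : Matrix κ κ ℚ} (hd : ∀ a, V a a ≠ 0)
    (hu : ∀ a b, V a b ≠ 0 → oκ.le a b) {c : κ → ℚ} {t : κ} (hc : IsLead oκ c t) :
    IsLead oκ (V *ᵥ c) t := by
  refine ⟨?_, fun i hi => ?_⟩
  · have : (V *ᵥ c) t = V t t * c t := by
      refine Finset.sum_eq_single t (fun j _ hj => ?_) (by simp)
      by_contra h
      exact hj (oκ.le_antisymm _ _ (hc.2 _ (right_ne_zero_of_mul h))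
        (hu _ _ (left_ne_zero_of_mul h)))
    rw [this]
    exact mul_ne_zero (hd t) hc.1
  · obtain ⟨j, _, hj⟩ := Finset.exists_ne_zero_of_sum_ne_zero hi
    exact oκ.le_trans _ _ _ (hu _ _ (left_ne_zero_of_mul hj)) (hc.2 _ (right_ne_zero_of_mul hj))

namespace IsRDV

variable [Fintype κ] [DecidableEq κ] {D R : Matrix ι κ ℚ} {V : Matrix κ κ ℚ}

theorem diag_ne_zero (h : IsRDV oι oκ D R V) (a : κ) : V a a ≠ 0 :=
  diag_ne_zero_of_upper h.invertible h.upper a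

theorem isLead_col (h : IsRDV oι oκ D R V) (a : κ) : IsLead oκ (fun i => V i a) a :=
  ⟨h.diag_ne_zero a, fun i hi => h.upper i a hi⟩

theorem mulVec_col (h : IsRDV oι oκ D R V) (a : κ) : D *ᵥ (fun i => V i a) = fun i => R i a := by
  rw [h.eq]
  rfl

/-- Coordinates in the basis of columns of `V`. Triangularity preserves leads, so questions about
`D` pass to the reduced matrix `R`. -/
theorem exists_coeff (h : IsRDV oι oκ D R V) (y : κ → ℚ) :
    ∃ c, y = V *ᵥ c ∧ D *ᵥ y = R *ᵥ c ∧ ∀ t, IsLead oκ y t → IsLead oκ c t := by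
  have hy : y = V *ᵥ (V⁻¹ *ᵥ y) := by
    rw [Matrix.mulVec_mulVec, Matrix.mul_nonsing_inv _ ((Matrix.isUnit_iff_isUnit_det V).1
      h.invertible), Matrix.one_mulVec]
  refine ⟨V⁻¹ *ᵥ y, hy, ?_, fun t ht => ?_⟩
  · rw [h.eq, ← Matrix.mulVec_mulVec, ← hy]
  · have h0 : V⁻¹ *ᵥ y ≠ 0 := by
      intro h0
      rw [h0, Matrix.mulVec_zero] at hy
      exact ht.ne_zero hy
    obtain ⟨t', ht'⟩ := exists_isLead oκ h0
    have h2 := ht'.mulVec_of_upper h.diag_ne_zero h.upper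
    rw [← hy] at h2
    rwa [ht.unique h2]

theorem exists_isLead_mulVec [Finite ι] (h : IsRDV oι oκ D R V) {y : κ → ℚ} {t : κ} {s : ι}
    (hy : IsLead oκ y t) (hs : IsLow oι R t s) :
    ∃ s', oι.le s s' ∧ IsLead oι (D *ᵥ y) s' := by
  obtain ⟨c, -, hc, hl⟩ := h.exists_coeff y
  obtain ⟨s', _, h1, -, h2⟩ := exists_isLead_mulVec_of_reduced h.reduced (hl t hy).1 hs
  exact ⟨s', h1, hc ▸ h2⟩

/-- A nonzero column `t` of `R` would give `D *ᵥ y` a leading entry. -/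
theorem col_eq_zero [Finite ι] (h : IsRDV oι oκ D R V) {y : κ → ℚ} {t : κ}
    (hy : IsLead oκ y t) (h0 : D *ᵥ y = 0) (r : ι) : R r t = 0 := by
  by_contra hr
  obtain ⟨s, hs⟩ := exists_isLow (oι := oι) hr
  obtain ⟨s', -, hs'⟩ := h.exists_isLead_mulVec hy hs
  exact hs'.ne_zero h0

theorem exists_isLow_of_isLead_mulVec [Finite ι] (h : IsRDV oι oκ D R V) {y : κ → ℚ} {s : ι}
    (hs : IsLead oι (D *ᵥ y) s) : ∃ t, IsLow oι R t s := by
  obtain ⟨c, -, hc, -⟩ := h.exists_coeff y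
  rw [hc] at hs
  obtain ⟨j, _, hj⟩ := Finset.exists_ne_zero_of_sum_ne_zero hs.1
  obtain ⟨l, hl⟩ := exists_isLow (oι := oι) (left_ne_zero_of_mul hj)
  obtain ⟨s', t, -, h1, h2⟩ :=
    exists_isLead_mulVec_of_reduced h.reduced (right_ne_zero_of_mul hj) hl
  rw [hs.unique h2]
  exact ⟨t, h1⟩

end IsRDV

end Reduced

/-! ### Minimizing a weighted `ℓ¹` norm over a rational affine subspace. -/

section WeightedNorm

variable {κ : Type*} [Fintype κ] (w : κ → ℝ)

/-- Moving from `v` along `e` until the first coordinate vanishes, no coordinate changes sign. The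
norm is thus affine on this segment, and the sum in `hs` is its slope. -/
theorem exists_smaller_support_of_descent {v e : κ → ℚ} (hev : ∀ a, e a ≠ 0 → v a ≠ 0)
    (hneg : ∃ a, v a * e a < 0)
    (hs : ∑ a, w a * ((if 0 < v a then e a else -e a : ℚ) : ℝ) ≤ 0) :
    ∃ r : ℚ, (∑ a, w a * |((v + r • e) a : ℝ)| ≤ ∑ a, w a * |(v a : ℝ)|) ∧
      (∀ a, (v + r • e) a ≠ 0 → v a ≠ 0) ∧ ∃ a, v a ≠ 0 ∧ (v + r • e) a = 0 := by
  obtain ⟨m, hm, hmin⟩ := Set.exists_min_image {a | v a * e a < 0} (fun a => -v a / e a)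
    (Set.toFinite _) hneg
  simp only [Set.mem_ofPred_eq] at hm hmin
  have hem : e m ≠ 0 := right_ne_zero_of_mul hm.ne
  -- The first time at which a coordinate of `v + r • e` reaches zero.
  set r := -v m / e m with hr
  have hr0 : 0 ≤ r := by
    rw [hr, show -v m / e m = -(v m * e m) / (e m) ^ 2 by field_simp]
    exact div_nonneg (by linarith) (sq_nonneg _)
  refine ⟨r, ?_, fun a ha h0 => ha ?_, m, left_ne_zero_of_mul hm.ne, ?_⟩
  · have habs : ∀ a, |(v + r • e) a| = |v a| + r * (if 0 < v a then e a else -e a) := by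
      intro a
      simp only [Pi.add_apply, Pi.smul_apply, smul_eq_mul]
      rcases lt_trichotomy (v a) 0 with h | h | h
      · rw [if_neg h.not_gt, abs_of_neg h, abs_of_nonpos]
        · ring
        rcases le_or_gt (e a) 0 with he | he
        · nlinarith
        · have := hmin a (mul_neg_of_neg_of_pos h he)
          rw [le_div_iff₀ he] at this
          linarith
      · have he : e a = 0 := by
          by_contra he
          exact hev a he h
        simp [h, he]
      · rw [if_pos h, abs_of_pos h, abs_of_nonneg]
        rcases le_or_gt 0 (e a) with he | he
        · positivity
        · have := hmin a (mul_neg_of_pos_of_neg h he)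
          rw [le_div_iff_of_neg he] at this
          linarith
    have hsum : ∑ a, w a * |((v + r • e) a : ℝ)| = ∑ a, w a * |(v a : ℝ)| +
        r * ∑ a, w a * ((if 0 < v a then e a else -e a : ℚ) : ℝ) := by
      rw [Finset.mul_sum, ← Finset.sum_add_distrib]
      refine Finset.sum_congr rfl fun a _ => ?_
      rw [← Rat.cast_abs, habs a, Rat.cast_add, Rat.cast_mul, Rat.cast_abs]
      ring
    rw [hsum]
    have : (r : ℝ) * ∑ a, w a * ((if 0 < v a then e a else -e a : ℚ) : ℝ) ≤ 0 :=
      mul_nonpos_of_nonneg_of_nonpos (by exact_mod_cast hr0) hs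
    linarith
  · have he : e a = 0 := by
      by_contra he
      exact hev a he h0
    simp [h0, he]
  · simp [hr, hem]

theorem exists_smaller_support (hw : ∀ a, 0 ≤ w a) {v d : κ → ℚ} (hd : d ≠ 0)
    (hdv : ∀ a, d a ≠ 0 → v a ≠ 0) :
    ∃ r : ℚ, (∑ a, w a * |((v + r • d) a : ℝ)| ≤ ∑ a, w a * |(v a : ℝ)|) ∧
      (∀ a, (v + r • d) a ≠ 0 → v a ≠ 0) ∧ ∃ a, v a ≠ 0 ∧ (v + r • d) a = 0 := by
  -- If no coordinate shrinks along `d`, the slope is also nonnegative, hence zero, and the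
  -- direction `-d` serves instead.
  have main : ∀ d : κ → ℚ, d ≠ 0 → (∀ a, d a ≠ 0 → v a ≠ 0) →
      ∑ a, w a * ((if 0 < v a then d a else -d a : ℚ) : ℝ) ≤ 0 →
      (∃ a, v a * d a < 0) ∨
        ∑ a, w a * ((if 0 < v a then d a else -d a : ℚ) : ℝ) = 0 ∧ ∃ a, v a * (-d) a < 0 := by
    intro d hd hdv hs
    by_cases hneg : ∃ a, v a * d a < 0
    · exact Or.inl hneg
    push Not at hneg
    refine Or.inr ⟨le_antisymm hs (Finset.sum_nonneg fun a _ => mul_nonneg (hw a) ?_), ?_⟩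
    · have := hneg a
      split_ifs with h
      · exact_mod_cast nonneg_of_mul_nonneg_right this h
      · have h1 : 0 ≤ -d a := by
          by_contra! h2
          have h3 : v a < 0 := lt_of_le_of_ne (not_lt.1 h) (hdv a (by linarith))
          nlinarith
        exact_mod_cast h1
    · obtain ⟨a, ha⟩ := Function.ne_iff.1 hd
      refine ⟨a, ?_⟩
      have := lt_of_le_of_ne (hneg a) (mul_ne_zero (hdv a ha) ha).symm
      simpa using this
  have hflip : ∑ a, w a * ((if 0 < v a then (-d) a else -(-d) a : ℚ) : ℝ) =
      -∑ a, w a * ((if 0 < v a then d a else -d a : ℚ) : ℝ) := by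
    rw [← Finset.sum_neg_distrib]
    refine Finset.sum_congr rfl fun a _ => ?_
    split_ifs <;> simp
  have hdv' : ∀ a, (-d) a ≠ 0 → v a ≠ 0 := fun a ha => hdv a (by simpa using ha)
  have neg : (∃ a, v a * (-d) a < 0) →
      ∑ a, w a * ((if 0 < v a then (-d) a else -(-d) a : ℚ) : ℝ) ≤ 0 →
      ∃ r : ℚ, (∑ a, w a * |((v + r • d) a : ℝ)| ≤ ∑ a, w a * |(v a : ℝ)|) ∧
        (∀ a, (v + r • d) a ≠ 0 → v a ≠ 0) ∧ ∃ a, v a ≠ 0 ∧ (v + r • d) a = 0 := fun h1 h2 => by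
    obtain ⟨r, hr⟩ := exists_smaller_support_of_descent w hdv' h1 h2
    refine ⟨-r, ?_⟩
    rwa [neg_smul, ← smul_neg]
  rcases le_total (∑ a, w a * ((if 0 < v a then d a else -d a : ℚ) : ℝ)) 0 with hs | hs
  · rcases main d hd hdv hs with h | ⟨h0, h⟩
    · exact exists_smaller_support_of_descent w hdv h hs
    · exact neg h (by rw [hflip, h0, neg_zero])
  · have hs' := hflip ▸ neg_nonpos.2 hs
    rcases main (-d) (neg_ne_zero.2 hd) hdv' hs' with h | ⟨h0, h⟩
    · exact neg h hs'
    · rw [neg_neg] at h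
      exact exists_smaller_support_of_descent w hdv h (by rw [hflip] at h0; linarith)

/-- A weighted `ℓ¹` norm attains its minimum on each rational affine subspace. -/
theorem exists_min_weighted_norm (hw : ∀ a, 0 ≤ w a) (L : Submodule ℚ (κ → ℚ)) (v₀ : κ → ℚ) :
    ∃ v, v - v₀ ∈ L ∧ ∀ v', v' - v₀ ∈ L →
      ∑ a, w a * |(v a : ℝ)| ≤ ∑ a, w a * |(v' a : ℝ)| := by
  classical
  let supp : (κ → ℚ) → Finset κ := fun v => Finset.univ.filter fun a => v a ≠ 0
  -- Points whose support carries no nonzero direction of `L`. Two of them with equal support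
  -- coincide, so there are finitely many; every other point descends to one of them.
  let B : Set (κ → ℚ) := {v | v - v₀ ∈ L ∧ ∀ d ∈ L, (∀ a, d a ≠ 0 → v a ≠ 0) → d = 0}
  have hfin : B.Finite := by
    refine Set.Finite.of_injOn (f := supp) (t := Set.univ) (fun _ _ => Set.mem_univ _) ?_
      (Set.toFinite _)
    intro v hv v' hv' h
    have h' : ∀ a, v a ≠ 0 ↔ v' a ≠ 0 := fun a => by simpa [supp] using Finset.ext_iff.1 h a
    refine sub_eq_zero.1 (hv.2 (v - v') ?_ fun a ha h0 => ha ?_)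
    · simpa using L.sub_mem hv.1 hv'.1
    · have := not_iff_not.2 (h' a)
      simp only [not_not] at this
      simp [h0, this.1 h0]
  have hdom : ∀ k, ∀ v, v - v₀ ∈ L → (supp v).card = k →
      ∃ u ∈ B, ∑ a, w a * |(u a : ℝ)| ≤ ∑ a, w a * |(v a : ℝ)| := by
    intro k
    induction k using Nat.strong_induction_on with
    | _ k ih =>
      intro v hv hk
      by_cases hB : v ∈ B
      · exact ⟨v, hB, le_rfl⟩
      obtain ⟨d, hdL, hdv, hd⟩ : ∃ d ∈ L, (∀ a, d a ≠ 0 → v a ≠ 0) ∧ d ≠ 0 := by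
        by_contra! h
        exact hB ⟨hv, h⟩
      obtain ⟨r, hr, hsub, a, ha, ha0⟩ := exists_smaller_support w hw hd hdv
      have hlt : (supp (v + r • d)).card < k := by
        rw [← hk]
        refine Finset.card_lt_card ⟨fun b hb => ?_, fun h => ?_⟩
        · simp only [supp, Finset.mem_filter, Finset.mem_univ, true_and] at hb ⊢
          exact hsub b hb
        · have h2 := @h a (by simpa [supp] using ha)
          simp only [supp, Finset.mem_filter] at h2
          exact h2.2 ha0
      obtain ⟨u, hu, hle⟩ := ih _ hlt (v + r • d)
        (by rw [add_sub_right_comm]; exact L.add_mem hv (L.smul_mem _ hdL)) rfl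
      exact ⟨u, hu, hle.trans hr⟩
  obtain ⟨u₀, hu₀, -⟩ := hdom _ v₀ (by simp) rfl
  obtain ⟨u, hu, hmin⟩ := Set.exists_min_image B (fun v => ∑ a, w a * |(v a : ℝ)|) hfin ⟨u₀, hu₀⟩
  refine ⟨u, hu.1, fun v' hv' => ?_⟩
  obtain ⟨u', hu', hle⟩ := hdom _ v' hv' rfl
  exact (hmin u' hu').trans hle

end WeightedNorm

/-! ### The boundary of a boundary vanishes. -/

/-- Removing the later vertex `v` leaves the position of `u` unchanged, while removing `u` shifts
`v` by one; hence opposite signs. -/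
theorem neg_one_pow_erase_add {V : Type*} [LinearOrder V] {s : Finset V} {u v : V}
    (hu : u ∈ s) (huv : u < v) :
    (-1 : ℚ) ^ (((s.erase v).filter (· < u)).card + (s.filter (· < v)).card) +
      (-1) ^ (((s.erase u).filter (· < v)).card + (s.filter (· < u)).card) = 0 := by
  have h1 : (s.erase v).filter (· < u) = s.filter (· < u) := by
    ext a
    simp only [Finset.mem_filter, Finset.mem_erase]
    exact ⟨fun h => ⟨h.1.2, h.2⟩, fun h => ⟨⟨(h.2.trans huv).ne, h.1⟩, h.2⟩⟩
  have h2 : ((s.erase u).filter (· < v)).card + 1 = (s.filter (· < v)).card := by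
    rw [Finset.filter_erase]
    exact Finset.card_erase_add_one (by simp [hu, huv])
  rw [h1, ← h2, ← add_assoc, pow_succ, add_comm (s.filter (· < u)).card]
  ring

theorem sum_erase_erase_eq_zero {V : Type*} [LinearOrder V] (s q : Finset V) :
    ∑ v ∈ s, ∑ u ∈ s.erase v, (if (s.erase v).erase u = q then
      (-1 : ℚ) ^ (((s.erase v).filter (· < u)).card + (s.filter (· < v)).card) else 0) = 0 := by
  rw [Finset.sum_sigma']
  refine Finset.sum_involution (fun x _ => ⟨x.2, x.1⟩) ?_ ?_ ?_ ?_
  · rintro ⟨v, u⟩ h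
    simp only [Finset.mem_sigma, Finset.mem_erase] at h
    obtain ⟨hv, huv, hu⟩ := h
    simp only [Finset.erase_right_comm (a := u) (b := v)]
    split_ifs
    · rcases lt_or_gt_of_ne huv with h | h
      · exact neg_one_pow_erase_add hu h
      · rw [add_comm]
        exact neg_one_pow_erase_add hv h
    · simp
  · rintro ⟨v, u⟩ h _ heq
    simp only [Finset.mem_sigma, Finset.mem_erase] at h
    simp only [Sigma.mk.injEq] at heq
    exact h.2.1 heq.1
  · rintro ⟨v, u⟩ h
    simp only [Finset.mem_sigma, Finset.mem_erase] at h ⊢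
    exact ⟨h.2.2, h.2.1.symm, h.1⟩
  · rintro ⟨v, u⟩ _
    rfl

/-! ### Births, deaths and lifespans in a filtration. -/

namespace Filtration

variable {V : Type*} {T : ℕ} (F : Filtration V T)

theorem firstTime_le_eps_iff {P : Fin (T + 1) → Prop} (hP : ∀ i j, i ≤ j → P i → P j)
    (i : Fin (T + 1)) : F.firstTime P ≤ ((F.eps i : ℝ) : WithTop ℝ) ↔ P i := by
  classical
  unfold firstTime
  constructor
  · intro h
    rw [Finset.inf_le_iff (WithTop.coe_lt_top _)] at h
    obtain ⟨j, hj, hle⟩ := h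
    rw [WithTop.coe_le_coe, F.eps_strictMono.le_iff_le] at hle
    exact hP j i hle (by simpa using hj)
  · intro h
    exact Finset.inf_le (f := fun i => ((F.eps i : ℝ) : WithTop ℝ)) (by simpa using h)

theorem eps_lt_firstTime_iff {P : Fin (T + 1) → Prop} (hP : ∀ i j, i ≤ j → P i → P j)
    (i : Fin (T + 1)) : ((F.eps i : ℝ) : WithTop ℝ) < F.firstTime P ↔ ¬ P i := by
  rw [← not_le, F.firstTime_le_eps_iff hP]

theorem firstTime_eq_top_iff (P : Fin (T + 1) → Prop) : F.firstTime P = ⊤ ↔ ∀ i, ¬ P i := by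
  classical
  unfold firstTime
  rw [Finset.inf_eq_top_iff]
  simp

theorem exists_eq_firstTime {P : Fin (T + 1) → Prop} {i : Fin (T + 1)} (hi : P i) :
    ∃ j, P j ∧ F.firstTime P = ((F.eps j : ℝ) : WithTop ℝ) := by
  classical
  obtain ⟨j, hj, h⟩ := Finset.exists_mem_eq_inf (Finset.univ.filter P) ⟨i, by simpa using hi⟩
    fun i => ((F.eps i : ℝ) : WithTop ℝ)
  exact ⟨j, by simpa using hj, h⟩

theorem firstTime_anti {P Q : Fin (T + 1) → Prop} (h : ∀ i, P i → Q i) :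
    F.firstTime Q ≤ F.firstTime P := by
  classical
  exact Finset.inf_mono fun i hi => by simpa using h i (by simpa using hi)

theorem mem_sub_mono {s : Finset V} {i j : Fin (T + 1)} (hij : i ≤ j) (h : s ∈ F.sub i) :
    s ∈ F.sub j :=
  (F.sub_mono hij : (F.sub i).faces ⊆ (F.sub j).faces) h

theorem simplexBirth_le_eps_iff {k : ℕ} (s : F.Cells k) (i : Fin (T + 1)) :
    F.simplexBirth s ≤ ((F.eps i : ℝ) : WithTop ℝ) ↔ s.1 ∈ F.sub i :=
  F.firstTime_le_eps_iff (fun _ _ h => F.mem_sub_mono h) i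

theorem exists_simplexBirth_eq {k : ℕ} (s : F.Cells k) :
    ∃ i, s.1 ∈ F.sub i ∧ F.simplexBirth s = ((F.eps i : ℝ) : WithTop ℝ) :=
  F.exists_eq_firstTime (i := Fin.last T) s.2.1

theorem mem_sub_of_le {k l : ℕ} {s : F.Cells k} {t : F.Cells l}
    (h : F.simplexBirth s ≤ F.simplexBirth t) {i : Fin (T + 1)} (ht : t.1 ∈ F.sub i) :
    s.1 ∈ F.sub i :=
  (F.simplexBirth_le_eps_iff s i).1 (h.trans ((F.simplexBirth_le_eps_iff t i).2 ht))

theorem simplexBirth_le_of_subset {k l : ℕ} {s : F.Cells k} {t : F.Cells l} (hs : s.1.Nonempty)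
    (h : s.1 ⊆ t.1) : F.simplexBirth s ≤ F.simplexBirth t :=
  F.firstTime_anti fun i ht => ((F.sub i).isRelLowerSet_faces ht).2 h hs

theorem nonempty_cell {k : ℕ} (s : F.Cells k) : s.1.Nonempty :=
  (F.total.isRelLowerSet_faces s.2.1).1

theorem Preserving.mem_sub {F : Filtration V T} {k : ℕ} {o : LinearOrder (F.Cells k)}
    (ho : F.Preserving o) {a b : F.Cells k} (h : o.le a b) {i : Fin (T + 1)} (hb : b.1 ∈ F.sub i) :
    a.1 ∈ F.sub i :=
  F.mem_sub_of_le (ho a b h) hb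

theorem chainsAt_mono (k : ℕ) : Monotone (F.chainsAt k) :=
  fun _ _ hij _ hc s hs => F.mem_sub_mono hij (hc s hs)

/-- Along a filtration-preserving order, no simplex of the support is born after the lead. -/
theorem mem_chainsAt_of_isLead {k : ℕ} {o : LinearOrder (F.Cells k)} (ho : F.Preserving o)
    {c : F.Chain k} {s : F.Cells k} (hc : IsLead o c s) (i : Fin (T + 1)) :
    c ∈ F.chainsAt k i ↔ s.1 ∈ F.sub i :=
  ⟨fun h => h s hc.1, fun h a ha => ho.mem_sub (hc.2 a ha) h⟩

theorem mem_chainsAt_last {k : ℕ} (c : F.Chain k) : c ∈ F.chainsAt k (Fin.last T) :=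
  fun s _ => s.2.1

variable [LinearOrder V]

theorem subset_of_bdry_ne_zero {n : ℕ} {r : F.Cells n} {s : F.Cells (n + 1)}
    (h : F.bdry n r s ≠ 0) : r.1 ⊆ s.1 := by
  obtain ⟨v, _, hv⟩ := Finset.exists_ne_zero_of_sum_ne_zero h
  have : s.1.erase v = r.1 := by
    by_contra h1
    simp [h1] at hv
  rw [← this]
  exact Finset.erase_subset _ _

theorem simplexBirth_le_of_bdry_ne_zero {n : ℕ} {r : F.Cells n} {s : F.Cells (n + 1)}
    (h : F.bdry n r s ≠ 0) : F.simplexBirth r ≤ F.simplexBirth s :=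
  F.simplexBirth_le_of_subset (F.nonempty_cell r) (F.subset_of_bdry_ne_zero h)

variable [Finite V]

theorem bdry_mul_bdry (n : ℕ) : F.bdry n * F.bdry (n + 1) = 0 := by
  ext q s
  rw [Matrix.mul_apply, Matrix.zero_apply, ← sum_erase_erase_eq_zero s.1 q.1]
  simp only [bdry, Finset.mul_sum]
  rw [Finset.sum_comm]
  refine Finset.sum_congr rfl fun v hv => ?_
  have hcard : (s.1.erase v).card = n + 1 := by
    rw [Finset.card_erase_of_mem hv, s.2.2]
    rfl
  have hmem : s.1.erase v ∈ F.total :=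
    (F.total.isRelLowerSet_faces s.2.1).2 (Finset.erase_subset _ _)
      (Finset.card_pos.1 (by omega))
  rw [Finset.sum_eq_single (⟨s.1.erase v, hmem, hcard⟩ : F.Cells (n + 1))]
  · simp only [if_true, Finset.sum_mul, pow_add]
    refine Finset.sum_congr rfl fun u _ => ?_
    split_ifs <;> simp
  · intro r _ hr
    rw [if_neg, mul_zero]
    intro h
    exact hr (Subtype.ext h.symm)
  · simp

theorem bdry_mulVec_mem_chainsAt {n : ℕ} {i : Fin (T + 1)} {c : F.Chain (n + 1)}
    (hc : c ∈ F.chainsAt (n + 1) i) : F.bdry n *ᵥ c ∈ F.chainsAt n i := by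
  intro r hr
  obtain ⟨s, _, hs⟩ := Finset.exists_ne_zero_of_sum_ne_zero hr
  exact F.mem_sub_of_le (F.simplexBirth_le_of_bdry_ne_zero (left_ne_zero_of_mul hs))
    (hc s (right_ne_zero_of_mul hs))

theorem boundariesAt_mono (n : ℕ) : Monotone (F.boundariesAt n) :=
  fun _ _ hij => Submodule.map_mono (F.chainsAt_mono _ hij)

theorem bdry_mulVec_bdry_mulVec {n : ℕ} (y : F.Chain (n + 2)) :
    F.bdry n *ᵥ (F.bdry (n + 1) *ᵥ y) = 0 := by
  rw [Matrix.mulVec_mulVec, F.bdry_mul_bdry, Matrix.zero_mulVec]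

theorem boundariesAt_le_cyclesAt (n : ℕ) (i : Fin (T + 1)) :
    F.boundariesAt n i ≤ F.cyclesAt n i := by
  rintro _ ⟨y, hy, rfl⟩
  exact ⟨F.bdry_mulVec_mem_chainsAt hy, F.bdry_mulVec_bdry_mulVec y⟩

theorem eps_mem_lifespan_iff {n : ℕ} (c : F.Chain (n + 1)) (i : Fin (T + 1)) :
    F.eps i ∈ F.lifespan c ↔ c ∈ F.chainsAt (n + 1) i ∧ c ∉ F.boundariesAt n i :=
  and_congr (F.firstTime_le_eps_iff (fun _ _ h hc => F.chainsAt_mono _ h hc) i)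
    (F.eps_lt_firstTime_iff (fun _ _ h hc => F.boundariesAt_mono _ h hc) i)

theorem death_eq_top_iff {n : ℕ} (c : F.Chain (n + 1)) :
    F.death c = ⊤ ↔ c ∉ F.boundariesAt n (Fin.last T) := by
  refine (F.firstTime_eq_top_iff _).trans ⟨fun h => h _, fun h i hi => h ?_⟩
  exact F.boundariesAt_mono n (Fin.le_last i) hi

end Filtration

/-! ### Feasibility and solvability of the triangle-loss program. -/

namespace Filtration

variable {V : Type*} {T : ℕ} {F : Filtration V T} {n : ℕ}
  {o : ∀ k, LinearOrder (F.Cells k)} {R : Matrix (F.Cells (n + 1)) (F.Cells (n + 2)) ℚ}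
  {U : Matrix (F.Cells (n + 2)) (F.Cells (n + 2)) ℚ}
  {p : F.Cells (n + 1) × F.Cells (n + 2)}

theorem isLead_of_support {v : F.Chain (n + 2)}
    (hsupp : ∀ a, v a ≠ 0 → a ∈ insert p.2 (F.upperWindow o p)) (hd : v p.2 ≠ 0) :
    IsLead (o (n + 2)) v p.2 := by
  refine ⟨hd, fun a ha => ?_⟩
  rcases hsupp a ha with h | h
  · rw [h]; exact (o (n + 2)).le_refl _
  · exact @le_of_lt _ (o (n + 2)).toPreorder _ _ h.2

variable [LinearOrder V] [Finite V]

/-- The birth bound in the window costs nothing: a simplex in the boundary is a face of some simplex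
at or before `p.2`, so it is born by then. -/
theorem le_of_bdry_mulVec_ne_zero (ho : F.Preserving (o (n + 2))) {v : F.Chain (n + 2)}
    (hv : IsLead (o (n + 2)) v p.2)
    (hwin : ∀ b ∈ F.lowerWindow o p, (F.bdry (n + 1) *ᵥ v) b = 0) (b : F.Cells (n + 1))
    (hb : (F.bdry (n + 1) *ᵥ v) b ≠ 0) : (o (n + 1)).le b p.1 := by
  refine @le_of_not_gt _ (o (n + 1)) _ _ fun hlt => hb (hwin b ⟨?_, hlt⟩)
  obtain ⟨a, _, ha⟩ := Finset.exists_ne_zero_of_sum_ne_zero hb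
  exact (F.simplexBirth_le_of_bdry_ne_zero (left_ne_zero_of_mul ha)).trans
    (ho _ _ (hv.2 a (right_ne_zero_of_mul ha)))

theorem Feasible.isLead {G : CoeffGroup} {v : F.Chain (n + 2)} (hv : F.Feasible o p G v) :
    IsLead (o (n + 2)) v p.2 :=
  isLead_of_support hv.support (by simp [hv.at_death])

theorem Feasible.isLead_bdry (ho : F.Preserving (o (n + 2))) {G : CoeffGroup}
    {v : F.Chain (n + 2)} (hv : F.Feasible o p G v) :
    IsLead (o (n + 1)) (F.bdry (n + 1) *ᵥ v) p.1 :=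
  ⟨hv.at_birth, le_of_bdry_mulVec_ne_zero ho hv.isLead hv.at_window⟩

/-- The constraint that the boundary does not vanish at the birth simplex is implied by the
others. -/
theorem feasible_rationals_iff (ho : F.Preserving (o (n + 2)))
    (hRU : IsRDV (o (n + 1)) (o (n + 2)) (F.bdry (n + 1)) R U)
    (hp : p ∈ F.finitePairs (o (n + 1)) R) {v : F.Chain (n + 2)} :
    F.Feasible o p .rationals v ↔
      (∀ a, v a ≠ 0 → a ∈ insert p.2 (F.upperWindow o p)) ∧
      (∀ b ∈ F.lowerWindow o p, (F.bdry (n + 1) *ᵥ v) b = 0) ∧ v p.2 = 1 := by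
  refine ⟨fun h => ⟨h.support, h.at_window, h.at_death⟩, fun ⟨h1, h2, h3⟩ =>
    ⟨h1, fun _ => Set.mem_univ _, ?_, h2, h3⟩⟩
  have hlead := isLead_of_support h1 (by simp [h3])
  -- Reducedness puts the lead of the boundary at or after `p.1`; the window constraints put it at
  -- or before.
  obtain ⟨s', hle, hs'⟩ := hRU.exists_isLead_mulVec hlead hp.1
  have := le_of_bdry_mulVec_ne_zero ho hlead h2 s' hs'.1
  rw [(o (n + 1)).le_antisymm _ _ hle this]
  exact hs'.1

/-- The witness is the column of `U` at `p.2`, normalized and truncated to simplices not born before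
`p.1`. The truncation does not affect boundary rows after `p.1`, since all cofaces of such a row are
born no earlier than `p.1`. -/
theorem exists_feasible (ho : ∀ k, F.Preserving (o k))
    (hRU : IsRDV (o (n + 1)) (o (n + 2)) (F.bdry (n + 1)) R U)
    (hp : p ∈ F.finitePairs (o (n + 1)) R) : ∃ v, F.Feasible o p .rationals v := by
  classical
  have hU := hRU.isLead_col p.2
  let v : F.Chain (n + 2) := fun a =>
    if F.simplexBirth p.1 ≤ F.simplexBirth a then (U p.2 p.2)⁻¹ * U a p.2 else 0
  refine ⟨v, (feasible_rationals_iff (ho _) hRU hp).2 ⟨fun a ha => ?_, fun b hb => ?_, ?_⟩⟩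
  · have h1 : F.simplexBirth p.1 ≤ F.simplexBirth a := by
      by_contra h
      exact ha (if_neg h)
    have h2 : U a p.2 ≠ 0 := fun h => ha (by simp [v, h])
    by_cases h : a = p.2
    · exact Or.inl h
    · exact Or.inr ⟨h1, @lt_of_le_of_ne _ (o (n + 2)).toPartialOrder _ _ (hU.2 a h2) h⟩
  · have hR : R b p.2 = 0 := by
      by_contra h
      exact @not_lt_of_ge _ (o (n + 1)).toPreorder _ _ (hp.1.2 b h) hb.2
    rw [← congrFun (hRU.mulVec_col p.2) b] at hR
    rw [← mul_zero (U p.2 p.2)⁻¹, ← hR, Matrix.mulVec, Matrix.mulVec, dotProduct, dotProduct,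
      Finset.mul_sum]
    refine Finset.sum_congr rfl fun a _ => ?_
    by_cases h : F.simplexBirth p.1 ≤ F.simplexBirth a
    · simp only [v, if_pos h]
      ring
    · have hba : F.bdry (n + 1) b a = 0 := by
        by_contra h0
        exact h ((ho _ _ _ (@le_of_lt _ (o (n + 1)).toPreorder _ _ hb.2)).trans
          (F.simplexBirth_le_of_bdry_ne_zero h0))
      simp [hba]
  · simp only [v, if_pos hp.2.le]
    exact inv_mul_cancel₀ hU.1

theorem exists_isSolution_rationals {w : F.Cells (n + 2) → ℝ} (hw : ∀ t, 0 ≤ w t)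
    (ho : ∀ k, F.Preserving (o k))
    (hRU : IsRDV (o (n + 1)) (o (n + 2)) (F.bdry (n + 1)) R U)
    (hp : p ∈ F.finitePairs (o (n + 1)) R) : ∃ v, F.IsSolution o p .rationals w v := by
  obtain ⟨v₀, hv₀⟩ := exists_feasible ho hRU hp
  -- The direction space of the feasible affine subspace.
  let L : Submodule ℚ (F.Chain (n + 2)) :=
    { carrier := {d | (∀ a ∉ insert p.2 (F.upperWindow o p), d a = 0) ∧
        (∀ b ∈ F.lowerWindow o p, (F.bdry (n + 1) *ᵥ d) b = 0) ∧ d p.2 = 0}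
      zero_mem' := by simp
      add_mem' := by
        rintro a b ⟨ha1, ha2, ha3⟩ ⟨hb1, hb2, hb3⟩
        refine ⟨fun c hc => by simp [ha1 c hc, hb1 c hc], fun c hc => ?_, by simp [ha3, hb3]⟩
        simp [Matrix.mulVec_add, ha2 c hc, hb2 c hc]
      smul_mem' := by
        rintro r a ⟨ha1, ha2, ha3⟩
        refine ⟨fun c hc => by simp [ha1 c hc], fun c hc => ?_, by simp [ha3]⟩
        simp [Matrix.mulVec_smul, ha2 c hc] }
  have hv₀s : ∀ a ∉ insert p.2 (F.upperWindow o p), v₀ a = 0 := fun a ha => by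
    by_contra h
    exact ha (hv₀.support a h)
  have hL : ∀ v, v - v₀ ∈ L ↔ F.Feasible o p .rationals v := by
    intro v
    rw [feasible_rationals_iff (ho _) hRU hp]
    constructor
    · rintro ⟨h1, h2, h3⟩
      refine ⟨fun a ha => ?_, fun b hb => ?_, ?_⟩
      · by_contra h
        have := h1 a h
        simp only [Pi.sub_apply, hv₀s a h, sub_zero] at this
        exact ha this
      · have := h2 b hb
        rwa [Matrix.mulVec_sub, Pi.sub_apply, hv₀.at_window b hb, sub_zero] at this
      · simpa [hv₀.at_death, sub_eq_zero] using h3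
    · rintro ⟨h1, h2, h3⟩
      refine ⟨fun a ha => ?_, fun b hb => ?_, ?_⟩
      · have : v a = 0 := by
          by_contra h
          exact ha (h1 a h)
        simp [this, hv₀s a ha]
      · rw [Matrix.mulVec_sub, Pi.sub_apply, hv₀.at_window b hb, h2 b hb, sub_zero]
      · simp [h3, hv₀.at_death]
  obtain ⟨v, hv, hmin⟩ := exists_min_weighted_norm w hw L v₀
  exact ⟨v, (hL v).1 hv, fun v' hv' => hmin v' ((hL v').2 hv')⟩

end Filtration

/-! ### Criteria for independence and for homology bases. -/

theorem exists_isLead_sum_smul {ι κ : Type*} [Fintype ι] [Finite κ] {o : LinearOrder κ}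
    {f : ι → κ → ℚ} {l : ι → κ} (hf : ∀ j, IsLead o (f j) (l j)) (hl : Function.Injective l)
    {a : ι → ℚ} (ha : a ≠ 0) : ∃ j, IsLead o (∑ j, a j • f j) (l j) := by
  obtain ⟨t, ht⟩ := Function.ne_iff.1 ha
  obtain ⟨s', t', -, h1, h2⟩ := exists_isLead_mulVec_of_reduced (oι := o)
    (R := Matrix.of fun k j => f j k)
    (fun j j' k hj hj' => hl (by rw [(hf j).unique hj, (hf j').unique hj'])) ht (hf t)
  refine ⟨t', ?_⟩
  rw [(hf t').unique h1]
  convert h2 using 1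
  ext k
  simp [Matrix.mulVec, dotProduct, mul_comm]

namespace IsLead

variable {κ : Type*} {o : LinearOrder κ}

theorem sub_of_lt {b c : κ → ℚ} {s : κ} (hb : IsLead o b s) (hc : ∀ a, c a ≠ 0 → o.lt a s) :
    IsLead o (b - c) s := by
  have hcs : c s = 0 := by
    by_contra h
    exact @lt_irrefl _ o.toPreorder s (hc s h)
  refine ⟨by simpa [hcs] using hb.1, fun a ha => ?_⟩
  by_cases h : b a = 0
  · exact @le_of_lt _ o.toPreorder _ _ (hc a fun h' => ha (by simp [h, h']))
  · exact hb.2 a h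

end IsLead

namespace Filtration

variable {V : Type*} {T : ℕ} {F : Filtration V T} {n : ℕ}

theorem finitePairs_ext {R : Matrix (F.Cells (n + 1)) (F.Cells (n + 2)) ℚ}
    {o : LinearOrder (F.Cells (n + 1))}
    {p q : F.Cells (n + 1) × F.Cells (n + 2)} (hp : p ∈ F.finitePairs o R)
    (hq : q ∈ F.finitePairs o R) (h : p.2 = q.2) : p = q := by
  refine Prod.ext (IsLead.unique (o := o) (b := fun a => R a p.2) hp.1 ?_) h
  rw [h]
  exact hq.1

variable [LinearOrder V] [Finite V]

theorem isHomologicalCycleBasis_range {ι : Type*} [Fintype ι] {i : Fin (T + 1)}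
    {f : ι → F.Chain (n + 1)} (hf : ∀ j, f j ∈ F.cyclesAt n i)
    (hli : ∀ a : ι → ℚ, ∑ j, a j • f j ∈ F.boundariesAt n i → a = 0)
    (hspan : F.cyclesAt n i ≤ F.boundariesAt n i ⊔ Submodule.span ℚ (Set.range f)) :
    F.IsHomologicalCycleBasis n i (Set.range f) := by
  have hB : Set.range f ⊆ F.cyclesAt n i := Set.range_subset_iff.2 hf
  refine ⟨hB, ?_⟩
  intro cls
  let g : ι → Set.range f := fun j => ⟨f j, j, rfl⟩
  let q : ι → F.HomologyAt n i := fun j => Submodule.Quotient.mk ⟨f j, hf j⟩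
  have hq : ∀ (a : ι → ℚ) (z : F.cyclesAt n i),
      (Submodule.Quotient.mk z : F.HomologyAt n i) = ∑ j, a j • q j ↔
        z.1 - ∑ j, a j • f j ∈ F.boundariesAt n i := by
    intro a z
    have hsum : ∑ j, a j • q j =
        (Submodule.Quotient.mk (∑ j, a j • (⟨f j, hf j⟩ : F.cyclesAt n i)) :
          F.HomologyAt n i) := by
      simp only [q, ← Submodule.mkQ_apply, map_sum, map_smul]
    rw [hsum, Submodule.Quotient.eq, Submodule.submoduleOf, Submodule.mem_comap]
    simp
  have hqli : LinearIndependent ℚ q := by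
    rw [Fintype.linearIndependent_iff]
    intro a ha
    have := (hq a 0).1 (by rw [ha]; rfl)
    refine congrFun (hli a ?_)
    simpa using this
  constructor
  · have hg : Function.Surjective g := by
      rintro ⟨_, j, rfl⟩
      exact ⟨j, rfl⟩
    -- The basis is indexed by the set of cycles; a section of `g` transfers independence from `ι`
    -- without a separate proof that `f` is injective.
    obtain ⟨h, hh⟩ := hg.hasRightInverse
    have : cls = q ∘ h := by
      funext z
      conv_lhs => rw [← hh z]
      rfl
    rw [this]
    exact hqli.comp h hh.injective
  · rw [eq_top_iff]
    rintro z -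
    obtain ⟨z, rfl⟩ := Submodule.Quotient.mk_surjective _ z
    obtain ⟨b, hb, c, hc, hbc⟩ := Submodule.mem_sup.1 (hspan z.2)
    obtain ⟨a, rfl⟩ := (Submodule.mem_span_range_iff_exists_fun ℚ).1 hc
    rw [(hq a z).2 (by rw [← hbc, add_sub_cancel_right]; exact hb)]
    exact Submodule.sum_mem _ fun j _ =>
      Submodule.smul_mem _ _ (Submodule.subset_span ⟨g j, rfl⟩)

/-! ### Cycles that die. -/

section FinitePart

variable {o : ∀ k, LinearOrder (F.Cells k)} {R : Matrix (F.Cells (n + 1)) (F.Cells (n + 2)) ℚ}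
  {U : Matrix (F.Cells (n + 2)) (F.Cells (n + 2)) ℚ}

/-- A boundary in `K` of a chain with leading simplex `t` is not a boundary before `t` is born. -/
theorem bdry_notMem_boundariesAt (ho : F.Preserving (o (n + 2)))
    (hRU : IsRDV (o (n + 1)) (o (n + 2)) (F.bdry (n + 1)) R U) {y : F.Chain (n + 2)}
    {s : F.Cells (n + 1)} {t : F.Cells (n + 2)} (hy : IsLead (o (n + 2)) y t)
    (hs : IsLow (o (n + 1)) R t s) {i : Fin (T + 1)} (ht : t.1 ∉ F.sub i) :
    F.bdry (n + 1) *ᵥ y ∉ F.boundariesAt n i := by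
  rintro ⟨c, hc, hcy⟩
  have hcy' : F.bdry (n + 1) *ᵥ c = F.bdry (n + 1) *ᵥ y := hcy
  -- The difference `y - c` would be a cycle with lead `t`.
  refine hs.1 (hRU.col_eq_zero (hy.sub_of_lt (c := c) fun a ha => ?_) ?_ s)
  · exact @lt_of_not_ge _ (o (n + 2)) _ _ fun h => ht (ho.mem_sub h (hc a ha))
  · rw [Matrix.mulVec_sub, hcy', sub_self]

variable {G : CoeffGroup} {x : F.Cells (n + 1) × F.Cells (n + 2) → F.Chain (n + 2)}

theorem bdry_mem_boundariesAt_iff (ho : F.Preserving (o (n + 2)))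
    (hRU : IsRDV (o (n + 1)) (o (n + 2)) (F.bdry (n + 1)) R U)
    {p : F.Cells (n + 1) × F.Cells (n + 2)} (hp : p ∈ F.finitePairs (o (n + 1)) R)
    {v : F.Chain (n + 2)} (hv : F.Feasible o p G v) (i : Fin (T + 1)) :
    F.bdry (n + 1) *ᵥ v ∈ F.boundariesAt n i ↔ p.2.1 ∈ F.sub i := by
  refine ⟨fun h => ?_, fun h => ⟨v, (F.mem_chainsAt_of_isLead ho hv.isLead i).2 h, rfl⟩⟩
  by_contra h'
  exact bdry_notMem_boundariesAt ho hRU hv.isLead hp.1 h' h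

/-- The lead `s` of such a boundary is the `low` of some column `t`. If `t` is present at stage `i`,
the column of `U` at `t` bounds with lead `s` there; otherwise `s` is born strictly before `t`, and
the boundary of `x (s, t)` has lead `s`. -/
theorem boundaries_inf_chainsAt_le (ho : ∀ k, F.Preserving (o k))
    (hRU : IsRDV (o (n + 1)) (o (n + 2)) (F.bdry (n + 1)) R U)
    (hx : ∀ p ∈ F.finitePairs (o (n + 1)) R, F.Feasible o p G (x p)) (i : Fin (T + 1)) :
    F.boundariesAt n (Fin.last T) ⊓ F.chainsAt (n + 1) i ≤ F.boundariesAt n i ⊔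
      Submodule.span ℚ {z | ∃ p ∈ F.finitePairs (o (n + 1)) R, p.1.1 ∈ F.sub i ∧
        p.2.1 ∉ F.sub i ∧ z = F.bdry (n + 1) *ᵥ x p} := by
  refine Submodule.le_of_forall_isLead (o (n + 1)) fun b hb s hs => ?_
  obtain ⟨⟨y, -, rfl⟩, hbi⟩ := hb
  have hsi : s.1 ∈ F.sub i := hbi s hs.1
  obtain ⟨t, ht⟩ := hRU.exists_isLow_of_isLead_mulVec (y := y) hs
  by_cases hti : t.1 ∈ F.sub i
  · have hlead : IsLead (o (n + 1)) (F.bdry (n + 1) *ᵥ fun a => U a t) s := by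
      rw [hRU.mulVec_col]
      exact ht
    have hmem : (F.bdry (n + 1) *ᵥ fun a => U a t) ∈ F.boundariesAt n i :=
      ⟨_, (F.mem_chainsAt_of_isLead (ho _) (hRU.isLead_col t) i).2 hti, rfl⟩
    exact ⟨_, Submodule.mem_sup_left hmem, ⟨F.boundariesAt_mono n (Fin.le_last i) hmem,
      (F.boundariesAt_le_cyclesAt n i hmem).1⟩, hlead⟩
  · have hp : (s, t) ∈ F.finitePairs (o (n + 1)) R := by
      refine ⟨ht, lt_of_not_ge fun h => hti (F.mem_sub_of_le h hsi)⟩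
    have hlead := (hx _ hp).isLead_bdry (ho _)
    exact ⟨_, Submodule.mem_sup_right (Submodule.subset_span ⟨_, hp, hsi, hti, rfl⟩),
      ⟨⟨x (s, t), F.mem_chainsAt_last _, rfl⟩,
        (F.mem_chainsAt_of_isLead (ho _) hlead i).2 hsi⟩, hlead⟩

end FinitePart

/-! ### Cycles that never die. -/

section InfinitePart

variable {o : ∀ k, LinearOrder (F.Cells k)} {R : Matrix (F.Cells n) (F.Cells (n + 1)) ℚ}
  {U : Matrix (F.Cells (n + 1)) (F.Cells (n + 1)) ℚ}
  {R' : Matrix (F.Cells (n + 1)) (F.Cells (n + 2)) ℚ}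
  {U' : Matrix (F.Cells (n + 2)) (F.Cells (n + 2)) ℚ}

theorem col_mem_cyclesAt (ho : ∀ k, F.Preserving (o k))
    (hRU : IsRDV (o n) (o (n + 1)) (F.bdry n) R U) {s : F.Cells (n + 1)}
    (hs : ∀ r, R r s = 0) {i : Fin (T + 1)} (hi : s.1 ∈ F.sub i) :
    (fun a => U a s) ∈ F.cyclesAt n i := by
  refine ⟨(F.mem_chainsAt_of_isLead (ho _) (hRU.isLead_col s) i).2 hi, ?_⟩
  refine (hRU.mulVec_col s).trans (funext hs)

/-- A paired lead `s` is matched by a column of `R'`, which is a chain of stage `i` but perhaps a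
boundary only later; this is why boundaries of all of `K` appear. An unpaired lead is matched by its
column of `U`. -/
theorem cyclesAt_le (ho : ∀ k, F.Preserving (o k))
    (hRU : IsRDV (o n) (o (n + 1)) (F.bdry n) R U)
    (hRU' : IsRDV (o (n + 1)) (o (n + 2)) (F.bdry (n + 1)) R' U') (i : Fin (T + 1)) :
    F.cyclesAt n i ≤ (F.boundariesAt n (Fin.last T) ⊓ F.chainsAt (n + 1) i) ⊔
      Submodule.span ℚ {z | ∃ s, (∀ r, R r s = 0) ∧ (∀ t, ¬ IsLow (o (n + 1)) R' t s) ∧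
        s.1 ∈ F.sub i ∧ z = fun a => U a s} := by
  refine Submodule.le_of_forall_isLead (o (n + 1)) fun b hb s hs => ?_
  have hsi : s.1 ∈ F.sub i := hb.1 s hs.1
  by_cases ht : ∃ t, IsLow (o (n + 1)) R' t s
  · obtain ⟨t, ht⟩ := ht
    have hlead : IsLead (o (n + 1)) (F.bdry (n + 1) *ᵥ fun a => U' a t) s := by
      rw [hRU'.mulVec_col]
      exact ht
    have hi := (F.mem_chainsAt_of_isLead (ho _) hlead i).2 hsi
    exact ⟨_, Submodule.mem_sup_left ⟨⟨_, F.mem_chainsAt_last _, rfl⟩, hi⟩,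
      ⟨hi, F.bdry_mulVec_bdry_mulVec _⟩, hlead⟩
  · push Not at ht
    have hR := hRU.col_eq_zero hs hb.2
    exact ⟨_, Submodule.mem_sup_right (Submodule.subset_span ⟨s, hR, ht, hsi, rfl⟩),
      col_mem_cyclesAt ho hRU hR hsi, hRU.isLead_col s⟩

/-- The elements of a standard basis that never die. -/
theorem IsStandardBasis.exists_infinite_part {M : Set (F.Chain (n + 1))}
    (hM : F.IsStandardBasis n M) :
    ∃ (o : LinearOrder (F.Cells (n + 1))) (_ : F.Preserving o) (E : Set (F.Cells (n + 1)))
      (u : F.Cells (n + 1) → F.Chain (n + 1)),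
      (∀ s, IsLead o (u s) s) ∧
      (∀ s ∈ E, ∀ i, s.1 ∈ F.sub i → u s ∈ F.cyclesAt n i) ∧
      (∀ b ∈ F.boundariesAt n (Fin.last T), ∀ s ∈ E, ¬ IsLead o b s) ∧
      (∀ i, F.cyclesAt n i ≤ (F.boundariesAt n (Fin.last T) ⊓ F.chainsAt (n + 1) i) ⊔
        Submodule.span ℚ {z | ∃ s ∈ E, s.1 ∈ F.sub i ∧ z = u s}) ∧
      {z ∈ M | F.death z = ⊤} = u '' E := by
  obtain ⟨o, ho, R, U, R', U', hRU, hRU', rfl⟩ := hM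
  have hnot : ∀ b ∈ F.boundariesAt n (Fin.last T), ∀ s, IsLead (o (n + 1)) b s →
      ∃ t, IsLow (o (n + 1)) R' t s := by
    rintro _ ⟨y, -, rfl⟩ s hs
    exact hRU'.exists_isLow_of_isLead_mulVec (y := y) hs
  refine ⟨o (n + 1), ho _, {s | (∀ r, R r s = 0) ∧ ∀ t, ¬ IsLow (o (n + 1)) R' t s},
    fun s a => U a s, hRU.isLead_col, fun s hs i hi => col_mem_cyclesAt ho hRU hs.1 hi,
    fun b hb s hs hl => ?_, fun i => ?_, ?_⟩
  · obtain ⟨t, ht⟩ := hnot b hb s hl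
    exact hs.2 t ht
  · convert cyclesAt_le ho hRU hRU' i using 5
    simp [and_assoc]
  · ext z
    constructor
    -- Columns of `R'` are boundaries in `K`, so only columns of `U` survive.
    · rintro ⟨⟨s, h1, h2, rfl⟩ | ⟨s, t, -, -, rfl⟩, hz⟩
      · exact ⟨s, ⟨h1, h2⟩, rfl⟩
      · rw [death_eq_top_iff] at hz
        exact absurd ⟨_, F.mem_chainsAt_last _, hRU'.mulVec_col t⟩ hz
    · rintro ⟨s, ⟨h1, h2⟩, rfl⟩
      refine ⟨Or.inl ⟨s, h1, h2, rfl⟩, (F.death_eq_top_iff _).2 fun hb => ?_⟩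
      obtain ⟨t, ht⟩ := hnot _ hb s (hRU.isLead_col s)
      exact h2 t ht

end InfinitePart

/-! ### Assembling the persistent basis. -/

theorem isPersistentBasis_output {o : ∀ k, LinearOrder (F.Cells k)}
    {R : Matrix (F.Cells (n + 1)) (F.Cells (n + 2)) ℚ}
    {U : Matrix (F.Cells (n + 2)) (F.Cells (n + 2)) ℚ} (ho : ∀ k, F.Preserving (o k))
    (hRU : IsRDV (o (n + 1)) (o (n + 2)) (F.bdry (n + 1)) R U) {G : CoeffGroup}
    {x : F.Cells (n + 1) × F.Cells (n + 2) → F.Chain (n + 2)}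
    (hx : ∀ p ∈ F.finitePairs (o (n + 1)) R, F.Feasible o p G (x p))
    {M : Set (F.Chain (n + 1))} (hM : F.IsStandardBasis n M) :
    F.IsPersistentBasis n (F.output (F.finitePairs (o (n + 1)) R) x M) := by
  classical
  obtain ⟨o', ho', E, u, hlead, hcyc, hnot, hspan, hE⟩ := hM.exists_infinite_part
  have hlast : ∀ s ∈ E, u s ∉ F.boundariesAt n (Fin.last T) := fun s hs hb =>
    hnot _ hb s hs (hlead s)
  have hz : ∀ p ∈ F.finitePairs (o (n + 1)) R, ∀ i,
      F.eps i ∈ F.lifespan (F.bdry (n + 1) *ᵥ x p) ↔ p.1.1 ∈ F.sub i ∧ p.2.1 ∉ F.sub i :=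
    fun p hp i => by
      rw [eps_mem_lifespan_iff, bdry_mem_boundariesAt_iff (ho _) hRU hp (hx p hp),
        F.mem_chainsAt_of_isLead (ho _) ((hx p hp).isLead_bdry (ho _))]
  have hu : ∀ s ∈ E, ∀ i, F.eps i ∈ F.lifespan (u s) ↔ s.1 ∈ F.sub i := fun s hs i => by
    rw [eps_mem_lifespan_iff, F.mem_chainsAt_of_isLead ho' (hlead s)]
    exact and_iff_left fun hb => hlast s hs (F.boundariesAt_mono n (Fin.le_last i) hb)
  unfold output
  rw [hE]
  refine ⟨?_, ?_, fun i => ?_⟩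
  · rintro _ (⟨p, hp, rfl⟩ | ⟨s, hs, rfl⟩)
    · exact ⟨F.mem_chainsAt_last _, F.bdry_mulVec_bdry_mulVec _⟩
    · exact hcyc s hs _ s.2.1
  · rintro _ (⟨p, hp, rfl⟩ | ⟨s, hs, rfl⟩)
    -- At the birth of `p.1` the simplex `p.2` is still absent, the inequality of births being
    -- strict.
    · obtain ⟨i, hi, hpi⟩ := F.exists_simplexBirth_eq p.1
      refine ⟨F.eps i, (hz p hp i).2 ⟨hi, fun h => ?_⟩⟩
      exact absurd hp.2 (not_lt_of_ge (hpi ▸ (F.simplexBirth_le_eps_iff _ _).2 h))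
    · exact ⟨_, (hu s hs (Fin.last T)).2 s.2.1⟩
  · let P := {p : F.Cells (n + 1) × F.Cells (n + 2) //
      p ∈ F.finitePairs (o (n + 1)) R ∧ p.1.1 ∈ F.sub i ∧ p.2.1 ∉ F.sub i}
    let S := {s : F.Cells (n + 1) // s ∈ E ∧ s.1 ∈ F.sub i}
    let f : P ⊕ S → F.Chain (n + 1) :=
      Sum.elim (fun p => F.bdry (n + 1) *ᵥ x p.1) (fun s => u s.1)
    have hrange : {z ∈ ({z | ∃ p ∈ F.finitePairs (o (n + 1)) R, z = F.bdry (n + 1) *ᵥ x p} ∪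
        u '' E : Set (F.Chain (n + 1))) | F.eps i ∈ F.lifespan z} = Set.range f := by
      ext z
      constructor
      · rintro ⟨⟨p, hp, rfl⟩ | ⟨s, hs, rfl⟩, hzi⟩
        · exact ⟨Sum.inl ⟨p, hp, (hz p hp i).1 hzi⟩, rfl⟩
        · exact ⟨Sum.inr ⟨s, hs, (hu s hs i).1 hzi⟩, rfl⟩
      · rintro ⟨⟨p, hp, hpi⟩ | ⟨s, hs, hsi⟩, rfl⟩
        · exact ⟨Or.inl ⟨p, hp, rfl⟩, (hz p hp i).2 hpi⟩
        · exact ⟨Or.inr ⟨s, hs, rfl⟩, (hu s hs i).2 hsi⟩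
    rw [hrange]
    let _ : Fintype P := Fintype.ofFinite _
    let _ : Fintype S := Fintype.ofFinite _
    refine isHomologicalCycleBasis_range ?_ (fun a ha => ?_) ?_
    · rintro (⟨p, hp, hpi⟩ | ⟨s, hs, hsi⟩)
      · exact ⟨((F.eps_mem_lifespan_iff _ i).1 ((hz p hp i).2 hpi)).1,
          F.bdry_mulVec_bdry_mulVec _⟩
      · exact hcyc s hs i hsi
    · have hfin : ∑ p : P, a (Sum.inl p) • f (Sum.inl p) =
          F.bdry (n + 1) *ᵥ ∑ p : P, a (Sum.inl p) • x p.1 := by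
        rw [Matrix.mulVec_sum]
        simp only [Matrix.mulVec_smul]
        rfl
      rw [Fintype.sum_sum_type, hfin] at ha
      -- The finite part is a boundary in `K`, so the infinite part is one too; its lead would lie
      -- in `E`.
      have hb : (fun s : S => a (Sum.inr s)) = 0 := by
        by_contra hb
        obtain ⟨s, hs⟩ := exists_isLead_sum_smul (o := o') (f := fun s : S => u s.1)
          (fun s => hlead s.1) Subtype.val_injective hb
        refine hnot _ ?_ s.1 s.2.1 hs
        have h1 := F.boundariesAt_mono n (Fin.le_last i) ha
        exact (Submodule.add_mem_iff_right (F.boundariesAt n (Fin.last T))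
          ⟨_, F.mem_chainsAt_last _, rfl⟩).1 h1
      have hb' : ∀ s : S, a (Sum.inr s) = 0 := congrFun hb
      -- The chains `x p` have distinct leads `p.2`, so a nonzero combination has one of them as
      -- lead, a simplex absent at stage `i`.
      have ha' : (fun p : P => a (Sum.inl p)) = 0 := by
        by_contra hne
        obtain ⟨p, hp⟩ := exists_isLead_sum_smul (f := fun p : P => x p.1)
          (fun p => (hx p.1 p.2.1).isLead)
          (fun p q h => Subtype.ext (finitePairs_ext p.2.1 q.2.1 h)) hne
        refine bdry_notMem_boundariesAt (ho _) hRU hp p.2.1.1 p.2.2.2 ?_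
        simpa [hb'] using ha
      funext j
      rcases j with p | s
      · exact congrFun ha' p
      · exact hb' s
    · refine (hspan i).trans (sup_le ((boundaries_inf_chainsAt_le ho hRU hx i).trans
        (sup_le_sup_left (Submodule.span_mono ?_) _)) (le_sup_of_le_right
        (Submodule.span_mono ?_)))
      · rintro _ ⟨p, hp, h1, h2, rfl⟩
        exact ⟨Sum.inl ⟨p, hp, h1, h2⟩, rfl⟩
      · rintro _ ⟨s, hs, h1, rfl⟩
        exact ⟨Sum.inr ⟨s, hs, h1⟩, rfl⟩

end Filtration

theorem mainTheorem4 {V : Type*} [LinearOrder V] [Finite V] {T : ℕ} (F : Filtration V T) (n : ℕ)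
    (w : F.Cells (n + 2) → ℝ) (hw : ∀ t, 0 ≤ w t)
    (o : ∀ k, LinearOrder (F.Cells k)) (ho : ∀ k, F.Preserving (o k))
    (R : Matrix (F.Cells (n + 1)) (F.Cells (n + 2)) ℚ)
    (U : Matrix (F.Cells (n + 2)) (F.Cells (n + 2)) ℚ)
    (hRU : IsRDV (o (n + 1)) (o (n + 2)) (F.bdry (n + 1)) R U) :
    (∀ p ∈ F.finitePairs (o (n + 1)) R, ∃ v, F.IsSolution o p .rationals w v) ∧
    ∀ (G : CoeffGroup) (x : F.Cells (n + 1) × F.Cells (n + 2) → F.Chain (n + 2))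
      (M : Set (F.Chain (n + 1))),
      (∀ p ∈ F.finitePairs (o (n + 1)) R, F.IsSolution o p G w (x p)) →
      F.IsStandardBasis n M →
      F.IsPersistentBasis n (F.output (F.finitePairs (o (n + 1)) R) x M) :=
  ⟨fun _ hp => Filtration.exists_isSolution_rationals hw ho hRU hp, fun _ _ _ hx hM =>
    Filtration.isPersistentBasis_output ho hRU (fun p hp => (hx p hp).1) hM⟩
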